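/- There is an absolute constant $C>0$ with the following property. Let $(X,\mathcal F,\nu)$ be a $\sigma$-finite measure space with a filtration $(\mathcal F_n)_{n\in\mathbb Z}$ (sub-$\sigma$-fields with $\mathcal F_n\subseteq\mathcal F_{n+1}\subseteq\mathcal F$) such that $\nu$ is $\sigma$-finite on each $\mathcal F_n$. Let $(f_n)_{n\in\mathbb Z}$ be a real- or complex-valued martingale: each $f_n$ is $\mathcal F_n$-measurable and integrable over every $A\in\mathcal F_n$ with $\nu(A)<\infty$, and $\int_A f_n\,d\nu=\int_A f_m\,d\nu$ whenever $m\le n$, $A\in\mathcal F_m$ and $\nu(A)<\infty$. Put $$\mathcal M(f)=\sup_{n\in\mathbb Z}|f_n|,\qquad s(f)=\Big(\sum_{n\in\mathbb Z}\mathbb E\big[|f_n-f_{n-1}|^2\,\big|\,\mathcal F_{n-1}\big]\Big)^{1/2},$$ $$V_r(f)=\sup_{n_0<n_1<\dots<n_J}\Big(\sum_{j=1}^J|f_{n_j}-f_{n_{j-1}}|^r\Big)^{1/r},$$ where the supremum is over all finite increasing sequences of integers, and all three functions take values in $[0,\infty]$. Then for all $\delta\in(0,\tfrac12)$, $r>2$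 and $\lambda>0$, $$C\cdot\nu\{V_r(f)>3\lambda,\ \mathcal M(f)\le\delta\lambda\}\ \le\ \nu\{s(f)>\delta\lambda\}+\frac{\delta^2}{(r-2)^2}\,\nu\{V_r(f)>\lambda\}.$$ Moreover, for all $p\in(0,\infty)$ and $r>2$, if $s(f)$ and $\mathcal M(f)$ belong to $L^p(X,\nu)$, then so does $V_r(f)$. -/

import Mathlib

open MeasureTheory
open scoped ENNReal

namespace MartingaleVariation

/-- Martingales indexed by `ℤ` on a `σ`-finite measure space. The `f n` need not be globally
integrable, only integrable over the sets of `ℱ n` of finite measure, so that martingales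
`n ↦ E[f | ℱ n]` with `f ∈ L^p`, `1 ≤ p ≤ ∞`, are included on spaces of infinite measure. The last
field says that `E[f n | ℱ m] = f m` for `m ≤ n`. On a finite measure space this is the
usual notion of a martingale. -/
structure IsMartingale {𝕜 X : Type*} [RCLike 𝕜] {mX : MeasurableSpace X}
    (ν : Measure X) (ℱ : Filtration ℤ mX) (f : ℤ → X → 𝕜) : Prop where
  adapted : ∀ n, StronglyMeasurable[ℱ n] (f n)
  integrableOn : ∀ n A, MeasurableSet[ℱ n] A → ν A < ∞ → IntegrableOn (f n) A ν
  setIntegral_eq : ∀ m n, m ≤ n → ∀ A, MeasurableSet[ℱ m] A → ν A < ∞ →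
    ∫ x in A, f n x ∂ν = ∫ x in A, f m x ∂ν

/-- The maximal function `M(f) = sup_n |f_n|`. -/
noncomputable def maximalFunction {𝕜 X : Type*} [RCLike 𝕜] (f : ℤ → X → 𝕜) (x : X) : ℝ≥0∞ :=
  ⨆ n : ℤ, ‖f n x‖ₑ

/-- The conditional square function `s(f) = (∑_n E[|f_n - f_{n-1}|² | ℱ_{n-1}])^{1/2}`, with the
conditional expectation of functions with values in `[0, ∞]`. -/
noncomputable def condSquareFunction {𝕜 X : Type*} [RCLike 𝕜] {mX : MeasurableSpace X}
    (ν : Measure X) (ℱ : Filtration ℤ mX) (f : ℤ → X → 𝕜) (x : X) : ℝ≥0∞ :=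
  (∑' n : ℤ, condLExp (ℱ (n - 1)) ν (fun y => ‖f n y - f (n - 1) y‖ₑ ^ 2) x) ^ (1 / 2 : ℝ)

/-- The `r`-variation: the supremum of `(∑_{j=1}^J |f_{n_j} - f_{n_{j-1}}|^r)^{1/r}` over all
finite sequences `n_0 < n_1 < ⋯ < n_J`. -/
noncomputable def variation {𝕜 X : Type*} [RCLike 𝕜] (r : ℝ) (f : ℤ → X → 𝕜) (x : X) : ℝ≥0∞ :=
  ⨆ (J : ℕ) (n : Fin (J + 1) → ℤ) (_ : StrictMono n),
    (∑ j : Fin J, ‖f (n j.succ) x - f (n j.castSucc) x‖ₑ ^ r) ^ (1 / r)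

end MartingaleVariation

/-! The inequality is first proved on a finite window. Let `τ` be the first time at which the
`r`-variation so far exceeds `λ`. Where `V_r > 3λ` and `M ≤ δλ`, the `r`-th power of the variation
before `τ` is at most `λ^r`, and the single increment of a chain that straddles `τ` contributes at
most `(2δλ)^r ≤ λ^r`. So at least `(3^r - 2) λ^r ≥ r² λ^r` must come from after `τ`.

After `τ` the increments are truncated predictably, as long as the conditional square function
allows it (`activeSet`). Where `s ≤ δλ` nothing is lost, and the truncated differences `d` have
total energy at most `(δλ)² ν{V_r > λ}`.

Variation is bounded by energy through counting. An increment of size about `2^{-k} D`, with `D =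
2δλ`, forces a reset of the walk with threshold `θ = 2^{-k} D / 4` (`one_le_sum_resetIndicator`). By
orthogonality each reset uses up `θ²` of the energy, so the integrated number of resets is at most
`θ^{-2}` times the energy (`lintegral_sum_resetIndicator_le`). With weights `(2^{-k} D)^r` the sum
over `k` is geometric with ratio `2^{-(r-2)}`, which is where `r > 2` enters (`tsum_dyadic_le`).
Chebyshev's inequality at height `r² λ^r` concludes (`measure_powVar_le`).

The `L^p` statement follows by integrating the inequality in `λ` and absorbing the variation term
for small `δ`. This is done on windows, where the variation is already known to be in `L^p`, and the
windows then exhaust `ℤ`. -/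

namespace MartingaleVariation

/-! ### Orthogonality of martingale differences -/

section Orthogonality

variable {𝕜 X : Type*} [RCLike 𝕜] {m mX : MeasurableSpace X} {ν : Measure X}

/-- The Pythagorean theorem for an `m`-measurable square integrable function and a square integrable
function whose integrals over `m`-measurable sets of finite measure vanish. -/
theorem lintegral_enorm_add_sq_of_setIntegral_eq_zero (hm : m ≤ mX) [SigmaFinite (ν.trim hm)]
    {h d : X → 𝕜} (hh : StronglyMeasurable[m] h) (hh2 : MemLp h 2 ν) (hd : Integrable d ν)
    (hd2 : MemLp d 2 ν)
    (hd0 : ∀ A, MeasurableSet[m] A → ν A < ∞ → ∫ x in A, d x ∂ν = 0) :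
    ∫⁻ x, ‖h x + d x‖ₑ ^ 2 ∂ν = ∫⁻ x, ‖h x‖ₑ ^ 2 ∂ν + ∫⁻ x, ‖d x‖ₑ ^ 2 ∂ν := by
  have hcond : ν[d | m] =ᵐ[ν] 0 :=
    (ae_eq_condExp_of_forall_setIntegral_eq hm hd (fun _ _ _ => integrableOn_zero)
      (fun s hs hs' => by simp [hd0 s hs hs']) aestronglyMeasurable_zero).symm
  have hint : Integrable (fun x => inner ℝ (h x) (d x)) ν := by
    refine (hh2.norm.integrable_mul hd2.norm).mono
      (hh2.aestronglyMeasurable.inner hd2.aestronglyMeasurable) (ae_of_all _ fun x => ?_)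
    simpa using norm_inner_le_norm (𝕜 := ℝ) (h x) (d x)
  have hzero : ∫ x, inner ℝ (h x) (d x) ∂ν = 0 := by
    have : ν[fun x => inner ℝ (h x) (d x) | m] =ᵐ[ν] fun x => inner ℝ (h x) (ν[d | m] x) :=
      condExp_bilin_of_stronglyMeasurable_left (innerSL ℝ (E := 𝕜)) hh hint hd
    rw [← integral_condExp hm]
    refine integral_eq_zero_of_ae ?_
    filter_upwards [this, hcond] with x hx hx0
    simpa [hx0] using hx
  have key : ∫ x, ‖h x + d x‖ ^ 2 ∂ν = ∫ x, ‖h x‖ ^ 2 ∂ν + ∫ x, ‖d x‖ ^ 2 ∂ν := by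
    simp_rw [norm_add_sq_real]
    rw [integral_add, integral_add, integral_const_mul, hzero]
    · ring
    · exact hh2.integrable_norm_pow (by norm_num)
    · exact hint.const_mul 2
    · exact (hh2.integrable_norm_pow (by norm_num)).add (hint.const_mul 2)
    · exact hd2.integrable_norm_pow (by norm_num)
  have conv : ∀ g : X → 𝕜, MemLp g 2 ν →
      ∫⁻ x, ‖g x‖ₑ ^ 2 ∂ν = ENNReal.ofReal (∫ x, ‖g x‖ ^ 2 ∂ν) := by
    intro g hg
    rw [ofReal_integral_eq_lintegral_ofReal (hg.integrable_norm_pow (by norm_num))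
      (ae_of_all _ fun x => by positivity)]
    simp_rw [ENNReal.ofReal_pow (norm_nonneg _), ofReal_norm]
  have := conv _ (hh2.add hd2)
  simp only [Pi.add_apply] at this
  rw [this, conv _ hh2, conv _ hd2, key, ENNReal.ofReal_add] <;> positivity

theorem memLp_two_iff_lintegral_enorm_sq_lt_top {g : X → 𝕜} (hg : AEStronglyMeasurable g ν) :
    MemLp g 2 ν ↔ ∫⁻ x, ‖g x‖ₑ ^ 2 ∂ν < ∞ := by
  rw [MemLp, eLpNorm_lt_top_iff_lintegral_rpow_enorm_lt_top (by norm_num) (by norm_num)]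
  simp [hg]

end Orthogonality

/-! ### Reset walks and the count of their resets -/

section ResetWalk

variable {𝕜 X : Type*} [RCLike 𝕜]

/-- The walk with increments `d k` that is reset to `0` as soon as its norm exceeds `θ`. -/
noncomputable def resetWalk (θ : ℝ) (d : ℕ → 𝕜) : ℕ → 𝕜
  | 0 => 0
  | k + 1 => if θ < ‖resetWalk θ d k + d k‖ then 0 else resetWalk θ d k + d k

/-- The indicator of a reset of `resetWalk` in the step from `k` to `k + 1`. -/
noncomputable def resetIndicator (θ : ℝ) (d : ℕ → 𝕜) (k : ℕ) : ℝ≥0∞ :=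
  if θ < ‖resetWalk θ d k + d k‖ then 1 else 0

theorem norm_resetWalk_le {θ : ℝ} (hθ : 0 ≤ θ) (d : ℕ → 𝕜) (k : ℕ) : ‖resetWalk θ d k‖ ≤ θ := by
  cases k with
  | zero => simpa [resetWalk] using hθ
  | succ k =>
    rw [resetWalk]
    split_ifs with h
    · simpa using hθ
    · exact not_lt.1 h

/-- Between two times at which the partial sums of `d` differ by more than `2θ` there is a
reset. -/
theorem one_le_sum_resetIndicator {θ : ℝ} (hθ : 0 ≤ θ) (d : ℕ → 𝕜) {a b : ℕ} (hab : a ≤ b)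
    (h : 2 * θ < ‖∑ i ∈ Finset.Ico a b, d i‖) :
    1 ≤ ∑ i ∈ Finset.Ico a b, resetIndicator θ d i := by
  by_cases hex : ∃ i ∈ Finset.Ico a b, θ < ‖resetWalk θ d i + d i‖
  · obtain ⟨i, hi, hlt⟩ := hex
    refine le_trans ?_ (Finset.single_le_sum (fun _ _ => zero_le) hi)
    simp [resetIndicator, hlt]
  · push Not at hex
    -- Without a reset the walk follows the partial sums, so their difference is that of two
    -- positions of norm at most `θ`.
    have hwalk : ∀ n, a ≤ n → n ≤ b →
        resetWalk θ d n = resetWalk θ d a + ∑ i ∈ Finset.Ico a n, d i := by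
      intro n han
      induction n, han using Nat.le_induction with
      | base => simp
      | succ n han ih =>
        intro hnb
        rw [Finset.sum_Ico_succ_top han, resetWalk,
          if_neg (not_lt.2 (hex n (Finset.mem_Ico.2 ⟨han, hnb⟩))), ih (by omega), add_assoc]
    have h1 := norm_resetWalk_le hθ d a
    have h2 := norm_resetWalk_le hθ d b
    have h3 : ∑ i ∈ Finset.Ico a b, d i = resetWalk θ d b - resetWalk θ d a := by
      rw [hwalk b hab le_rfl]; ring
    have h4 := norm_sub_le (resetWalk θ d b) (resetWalk θ d a)
    rw [h3] at h
    linarith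

/-- A reset replaces a squared norm above `θ²` by zero, which pays for the indicator; a step without
reset leaves the walk as it is. -/
theorem resetIndicator_add_enorm_sq_le {θ : ℝ} (hθ : 0 ≤ θ) (d : ℕ → 𝕜) (k : ℕ) :
    ENNReal.ofReal (θ ^ 2) * resetIndicator θ d k + ‖resetWalk θ d (k + 1)‖ₑ ^ 2 ≤
      ‖resetWalk θ d k + d k‖ₑ ^ 2 := by
  rw [resetWalk, resetIndicator]
  split_ifs with h
  · have hle : ENNReal.ofReal θ ≤ ‖resetWalk θ d k + d k‖ₑ := by
      rw [← ofReal_norm]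
      exact ENNReal.ofReal_le_ofReal h.le
    simpa [ENNReal.ofReal_pow hθ] using pow_le_pow_left' hle 2
  · simp

variable {mX : MeasurableSpace X} {ν : Measure X} {F : Filtration ℕ mX} {d : ℕ → X → 𝕜}

theorem stronglyMeasurable_resetWalk (θ : ℝ) (hd : ∀ k, StronglyMeasurable[F (k + 1)] (d k))
    (k : ℕ) : StronglyMeasurable[F k] fun x => resetWalk θ (fun i => d i x) k := by
  induction k with
  | zero => simpa only [resetWalk] using stronglyMeasurable_const
  | succ k ih =>
    have hsum : StronglyMeasurable[F (k + 1)]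
        fun x => resetWalk θ (fun i => d i x) k + d k x :=
      (ih.mono (F.mono k.le_succ)).add (hd k)
    simp only [resetWalk]
    exact StronglyMeasurable.ite (measurableSet_lt measurable_const hsum.norm.measurable)
      stronglyMeasurable_const hsum

theorem measurable_resetIndicator (θ : ℝ) (hd : ∀ k, StronglyMeasurable[F (k + 1)] (d k))
    (k : ℕ) : Measurable fun x => resetIndicator θ (fun i => d i x) k := by
  have hsum : StronglyMeasurable fun x => resetWalk θ (fun i => d i x) k + d k x :=
    ((stronglyMeasurable_resetWalk θ hd k).mono (F.le k)).add ((hd k).mono (F.le _))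
  exact Measurable.ite (measurableSet_lt measurable_const hsum.norm.measurable)
    measurable_const measurable_const

/-- The number of resets of the walk with martingale differences `d k` is controlled by the
energy of the differences. -/
theorem lintegral_sum_resetIndicator_le [SigmaFiniteFiltration ν F] {θ : ℝ} (hθ : 0 ≤ θ)
    (hd : ∀ k, StronglyMeasurable[F (k + 1)] (d k)) (hd1 : ∀ k, Integrable (d k) ν)
    (hd2 : ∀ k, MemLp (d k) 2 ν)
    (hd0 : ∀ k A, MeasurableSet[F k] A → ν A < ∞ → ∫ x in A, d k x ∂ν = 0) (K : ℕ) :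
    ENNReal.ofReal (θ ^ 2) *
        ∫⁻ x, ∑ k ∈ Finset.range K, resetIndicator θ (fun i => d i x) k ∂ν ≤
      ∑ k ∈ Finset.range K, ∫⁻ x, ‖d k x‖ₑ ^ 2 ∂ν := by
  have hmeas := fun k => measurable_resetIndicator θ hd k
  have hfin : ∀ k, ∫⁻ x, ‖d k x‖ₑ ^ 2 ∂ν < ∞ := fun k =>
    (memLp_two_iff_lintegral_enorm_sq_lt_top (hd2 k).1).1 (hd2 k)
  -- The remaining energy of the walk is kept on the left so that induction closes. The same bound
  -- shows that the walk is square integrable, as orthogonality requires.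
  suffices h : ENNReal.ofReal (θ ^ 2) *
        ∫⁻ x, ∑ k ∈ Finset.range K, resetIndicator θ (fun i => d i x) k ∂ν +
      ∫⁻ x, ‖resetWalk θ (fun i => d i x) K‖ₑ ^ 2 ∂ν ≤
      ∑ k ∈ Finset.range K, ∫⁻ x, ‖d k x‖ₑ ^ 2 ∂ν from le_self_add.trans h
  induction K with
  | zero => simp [resetWalk]
  | succ K ih =>
    have hsm := stronglyMeasurable_resetWalk θ hd K
    have hL2 : MemLp (fun x => resetWalk θ (fun i => d i x) K) 2 ν := by
      rw [memLp_two_iff_lintegral_enorm_sq_lt_top (hsm.mono (F.le K)).aestronglyMeasurable]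
      exact (le_add_self.trans ih).trans_lt (ENNReal.sum_lt_top.2 fun k _ => hfin k)
    have horth := lintegral_enorm_add_sq_of_setIntegral_eq_zero (F.le K) hsm hL2 (hd1 K) (hd2 K)
      (hd0 K)
    have hstep : ENNReal.ofReal (θ ^ 2) * ∫⁻ x, resetIndicator θ (fun i => d i x) K ∂ν +
        ∫⁻ x, ‖resetWalk θ (fun i => d i x) (K + 1)‖ₑ ^ 2 ∂ν ≤
        ∫⁻ x, ‖resetWalk θ (fun i => d i x) K + d K x‖ₑ ^ 2 ∂ν := by
      rw [← lintegral_const_mul _ (hmeas K), ← lintegral_add_left ((hmeas K).const_mul _)]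
      exact lintegral_mono fun x => resetIndicator_add_enorm_sq_le hθ _ K
    simp_rw [Finset.sum_range_succ]
    rw [lintegral_add_right _ (hmeas K), mul_add, add_assoc]
    calc _ ≤ _ := add_le_add_right (hstep.trans_eq horth) _
      _ = _ := (add_assoc _ _ _).symm
      _ ≤ _ := add_le_add_left ih _

end ResetWalk

/-! ### Variation of a finite stretch -/

section PowVar

variable {𝕜 X : Type*} [RCLike 𝕜]

/-- The `r`-th power of the `r`-variation of `f 0, …, f n`, as a supremum over chains that need
not be strictly monotone. -/
noncomputable def powVar (r : ℝ) (f : ℕ → 𝕜) (n : ℕ) : ℝ≥0∞ :=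
  ⨆ (J : ℕ) (u : Fin (J + 1) → ℕ) (_ : Monotone u) (_ : ∀ i, u i ≤ n),
    ∑ j : Fin J, ‖f (u j.succ) - f (u j.castSucc)‖ₑ ^ r

theorem le_powVar (r : ℝ) (f : ℕ → 𝕜) {n J : ℕ} {u : Fin (J + 1) → ℕ} (hu : Monotone u)
    (hn : ∀ i, u i ≤ n) :
    ∑ j : Fin J, ‖f (u j.succ) - f (u j.castSucc)‖ₑ ^ r ≤ powVar r f n :=
  le_iSup₂_of_le J u (le_iSup₂_of_le hu hn le_rfl)

theorem powVar_le {r : ℝ} {f : ℕ → 𝕜} {n : ℕ} {c : ℝ≥0∞}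
    (h : ∀ (J : ℕ) (u : Fin (J + 1) → ℕ), Monotone u → (∀ i, u i ≤ n) →
      ∑ j : Fin J, ‖f (u j.succ) - f (u j.castSucc)‖ₑ ^ r ≤ c) : powVar r f n ≤ c :=
  iSup₂_le fun J u => iSup₂_le (h J u)

theorem powVar_mono (r : ℝ) (f : ℕ → 𝕜) : Monotone (powVar r f) := fun _ _ hmn =>
  powVar_le fun _ _ hu hn => le_powVar r f hu fun i => (hn i).trans hmn

theorem powVar_zero {r : ℝ} (hr : 0 < r) (f : ℕ → 𝕜) : powVar r f 0 = 0 := by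
  refine le_antisymm (powVar_le fun J u _ hn => ?_) zero_le
  simp [fun i => Nat.le_zero.1 (hn i), ENNReal.zero_rpow_of_pos hr]

theorem measurable_powVar {mX : MeasurableSpace X} (F : Filtration ℕ mX) (r : ℝ)
    {f : ℕ → X → 𝕜} (hf : ∀ n, StronglyMeasurable[F n] (f n)) (n : ℕ) :
    Measurable[F n] fun x => powVar r (fun k => f k x) n := by
  unfold powVar
  refine Measurable.iSup fun J => Measurable.iSup fun u => Measurable.iSup_Prop _ ?_
  by_cases hn : ∀ i, u i ≤ n
  · simp only [hn, implies_true, iSup_pos]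
    refine Finset.measurable_fun_sum _ fun j _ => Measurable.pow_const (β := ℝ≥0∞) ?_ r
    exact (((hf _).mono (F.mono (hn _))).sub ((hf _).mono (F.mono (hn _)))).enorm
  · simp only [hn, iSup_false]
    exact measurable_const

end PowVar

/-! ### Pathwise control of the variation by resets -/

section Pathwise

variable {𝕜 : Type*} [RCLike 𝕜]

theorem sum_sum_Ico_eq {φ : ℕ → ℝ≥0∞} {J : ℕ} {u : Fin (J + 1) → ℕ} (hu : Monotone u) :
    ∑ j : Fin J, ∑ i ∈ Finset.Ico (u j.castSucc) (u j.succ), φ i =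
      ∑ i ∈ Finset.Ico (u 0) (u (Fin.last J)), φ i := by
  induction J with
  | zero => simp
  | succ J ih =>
    rw [Fin.sum_univ_castSucc]
    have := ih (u := fun i => u i.castSucc) fun i j hij => hu (by simpa using hij)
    simp only [Fin.succ_castSucc] at this ⊢
    rw [this, Fin.succ_last]
    exact Finset.sum_Ico_consecutive _ (hu (Fin.zero_le _)) (hu (Fin.le_last _))

/-- The number of resets at times in `s` of the walks at the dyadic scales `D, D / 2, D / 4, …`,
weighted by the `r`-th powers of the scales. -/
noncomputable def resetEnergy (r D : ℝ) (d : ℕ → 𝕜) (s : Finset ℕ) : ℝ≥0∞ :=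
  ∑' k : ℕ, ENNReal.ofReal ((D * (1 / 2) ^ k) ^ r) *
    ∑ i ∈ s, resetIndicator (D * (1 / 2) ^ k / 4) d i

/-- The `r`-th power of an increment bounded by `D` is controlled by the resets of the walks. -/
theorem enorm_sum_Ico_rpow_le_resetEnergy {r D : ℝ} (hr : 0 < r) (hD : 0 < D) (d : ℕ → 𝕜)
    {a b : ℕ} (hab : a ≤ b) (h : ‖∑ i ∈ Finset.Ico a b, d i‖ ≤ D) :
    ‖∑ i ∈ Finset.Ico a b, d i‖ₑ ^ r ≤ resetEnergy r D d (Finset.Ico a b) := by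
  set e := ∑ i ∈ Finset.Ico a b, d i with he
  rcases eq_or_ne e 0 with h0 | h0
  · simp [h0, ENNReal.zero_rpow_of_pos hr]
  · have hpos : 0 < ‖e‖ := norm_pos_iff.2 h0
    obtain ⟨k, hk1, hk2⟩ := exists_nat_pow_near_of_lt_one (x := ‖e‖ / D) (y := 1 / 2)
      (by positivity) ((div_le_one hD).2 h) (by norm_num) (by norm_num)
    rw [lt_div_iff₀ hD] at hk1
    rw [div_le_iff₀ hD] at hk2
    refine le_trans ?_ (ENNReal.le_tsum k)
    -- The divisor 4 makes twice the threshold equal to the lower end `D / 2 ^ (k + 1)` of the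
    -- dyadic range containing `‖e‖`.
    have h1 : 1 ≤ ∑ i ∈ Finset.Ico a b, resetIndicator (D * (1 / 2) ^ k / 4) d i := by
      refine one_le_sum_resetIndicator (by positivity) d hab ?_
      rw [← he]
      calc 2 * (D * (1 / 2) ^ k / 4) = (1 / 2) ^ (k + 1) * D := by ring
        _ < _ := hk1
    calc ‖e‖ₑ ^ r = ENNReal.ofReal (‖e‖ ^ r) := by
          rw [← ofReal_norm, ENNReal.ofReal_rpow_of_nonneg (norm_nonneg _) hr.le]
      _ ≤ ENNReal.ofReal ((D * (1 / 2) ^ k) ^ r) * 1 := by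
          rw [mul_one, mul_comm D]
          gcongr
      _ ≤ _ := by gcongr

theorem sum_resetEnergy_le (r D : ℝ) (d : ℕ → 𝕜) {J K : ℕ} {u : Fin (J + 1) → ℕ}
    (hu : Monotone u) (hK : ∀ i, u i ≤ K) :
    ∑ j : Fin J, resetEnergy r D d (Finset.Ico (u j.castSucc) (u j.succ)) ≤
      resetEnergy r D d (Finset.range K) := by
  simp only [resetEnergy]
  rw [← Summable.tsum_finsetSum fun _ _ => ENNReal.summable]
  refine ENNReal.tsum_le_tsum fun k => ?_
  rw [← Finset.mul_sum, sum_sum_Ico_eq hu]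
  gcongr
  intro i hi
  exact Finset.mem_range.2 ((Finset.mem_Ico.1 hi).2.trans_le (hK _))

/-- A chain is split at the time `τ`. -/
theorem sum_enorm_rpow_le_split {r D : ℝ} (hr : 0 < r) {f : ℕ → 𝕜} {τ J K : ℕ} (hτ : 1 ≤ τ)
    {u : Fin (J + 1) → ℕ} (hu : Monotone u) (hK : ∀ i, u i ≤ K)
    (hD : ∀ i ≤ K, ∀ j ≤ K, ‖f i - f j‖ ≤ D) :
    ∑ j : Fin J, ‖f (u j.succ) - f (u j.castSucc)‖ₑ ^ r ≤
      powVar r f (τ - 1) + ENNReal.ofReal D ^ r +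
        ∑ j : Fin J, ‖f (max (u j.succ) τ) - f (max (u j.castSucc) τ)‖ₑ ^ r := by
  -- A link lies before `τ`, straddles it, or lies after it. Clipping at `τ - 1` and at `τ` leaves
  -- monotone chains, whose repetitions contribute nothing harmful.
  have hterm : ∀ j : Fin J, ‖f (u j.succ) - f (u j.castSucc)‖ₑ ^ r ≤
      ‖f (min (u j.succ) (τ - 1)) - f (min (u j.castSucc) (τ - 1))‖ₑ ^ r +
      (if u j.castSucc < τ ∧ τ ≤ u j.succ then ENNReal.ofReal D ^ r else 0) +
      ‖f (max (u j.succ) τ) - f (max (u j.castSucc) τ)‖ₑ ^ r := by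
    intro j
    have hj : u j.castSucc ≤ u j.succ := hu (Fin.castSucc_le_succ j)
    rcases lt_or_ge (u j.succ) τ with h1 | h1
    · rw [min_eq_left (by omega : u j.succ ≤ τ - 1),
        min_eq_left (by omega : u j.castSucc ≤ τ - 1), add_assoc]
      exact le_self_add
    rcases lt_or_ge (u j.castSucc) τ with h2 | h2
    · rw [if_pos ⟨h2, h1⟩]
      refine le_trans ?_ (le_add_right le_add_self)
      gcongr
      rw [← ofReal_norm]
      exact ENNReal.ofReal_le_ofReal (hD _ (hK _) _ (hK _))
    · rw [max_eq_left h1, max_eq_left h2]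
      exact le_add_self
  refine (Finset.sum_le_sum fun j _ => hterm j).trans ?_
  rw [Finset.sum_add_distrib, Finset.sum_add_distrib]
  gcongr
  · exact le_powVar r f (u := fun i => min (u i) (τ - 1))
      (fun i j hij => min_le_min_right _ (hu hij)) fun i => min_le_right _ _
  · rw [← Finset.sum_filter, Finset.sum_const]
    -- By monotonicity, only one link can straddle `τ`.
    have hcard : (Finset.univ.filter fun j : Fin J =>
        u j.castSucc < τ ∧ τ ≤ u j.succ).card ≤ 1 := by
      rw [Finset.card_le_one]
      intro i hi j hj
      simp only [Finset.mem_filter, Finset.mem_univ, true_and] at hi hj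
      by_contra hne
      rcases lt_or_gt_of_ne hne with h | h
      · have := hu (show i.succ ≤ j.castSucc from h)
        omega
      · have := hu (show j.succ ≤ i.castSucc from h)
        omega
    calc _ ≤ 1 • ENNReal.ofReal D ^ r := nsmul_le_nsmul_left zero_le hcard
      _ = _ := one_nsmul _

/-- If `d` are the increments of `f` after time `τ`, the variation of `f` is controlled by its
variation before time `τ`, a single jump, and the resets of the walks with increments `d`. -/
theorem powVar_le_resetEnergy {r D : ℝ} (hr : 0 < r) (hD0 : 0 < D) {f d : ℕ → 𝕜} {τ K : ℕ}
    (hτ : 1 ≤ τ) (hτK : τ ≤ K) (hD : ∀ i ≤ K, ∀ j ≤ K, ‖f i - f j‖ ≤ D)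
    (hd : ∀ k, τ ≤ k → k < K → d k = f (k + 1) - f k) :
    powVar r f K ≤ powVar r f (τ - 1) + ENNReal.ofReal D ^ r +
      resetEnergy r D d (Finset.range K) := by
  refine powVar_le fun J u hu hK => (sum_enorm_rpow_le_split hr hτ hu hK hD).trans ?_
  have hv : Monotone fun i => max (u i) τ := fun i j hij => max_le_max_right _ (hu hij)
  have hvK : ∀ i, max (u i) τ ≤ K := fun i => max_le (hK i) hτK
  gcongr
  refine le_trans (Finset.sum_le_sum fun j _ => ?_) (sum_resetEnergy_le r D d hv hvK)
  have hj : max (u j.castSucc) τ ≤ max (u j.succ) τ := hv (Fin.castSucc_le_succ j)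
  have hsum : ∑ i ∈ Finset.Ico (max (u j.castSucc) τ) (max (u j.succ) τ), d i =
      f (max (u j.succ) τ) - f (max (u j.castSucc) τ) := by
    rw [← Finset.sum_Ico_sub f hj]
    refine Finset.sum_congr rfl fun i hi => hd i ?_ ?_
    · exact (le_max_right _ _).trans (Finset.mem_Ico.1 hi).1
    · exact (Finset.mem_Ico.1 hi).2.trans_le (hvK _)
  rw [← hsum]
  refine enorm_sum_Ico_rpow_le_resetEnergy hr hD0 d hj ?_
  rw [hsum]
  exact hD _ (hvK _) _ (hvK _)

end Pathwise

/-! ### Numerical inequalities and the sum over scales -/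

section RealEstimates

/-- Bernoulli's inequality gives `3^(r/2) ≥ 1 + r`; squaring suffices. The 2 accounts for the two
terms `λ^r` lost before and at `τ`. -/
theorem sq_add_two_le_three_rpow {r : ℝ} (hr : 2 < r) : r ^ 2 + 2 ≤ (3 : ℝ) ^ r := by
  have h1 : 1 + (r / 2) * 2 ≤ (1 + 2 : ℝ) ^ (r / 2) :=
    one_add_mul_self_le_rpow_one_add (by norm_num) (by linarith)
  have h2 : (3 : ℝ) ^ r = (1 + 2 : ℝ) ^ (r / 2) * (1 + 2 : ℝ) ^ (r / 2) := by
    rw [← Real.rpow_add (by norm_num)]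
    norm_num
  rw [h2]
  nlinarith

/-- Since `log 2 ≥ 1/2`, `2^(r-2) ≥ 1 + (r-2)/2 = r/2`. This bounds the geometric series over scales
by `r / (r - 2)`. -/
theorem one_half_rpow_le {r : ℝ} (hr : 2 < r) : (1 / 2 : ℝ) ^ (r - 2) ≤ 1 - (r - 2) / r := by
  have h2 : 1 + (r - 2) / 2 ≤ (2 : ℝ) ^ (r - 2) := by
    have h := Real.add_one_le_exp (Real.log 2 * (r - 2))
    rw [← Real.rpow_def_of_pos (by norm_num)] at h
    nlinarith [Real.log_two_gt_d9]
  have h3 : (1 / 2 : ℝ) ^ (r - 2) = ((2 : ℝ) ^ (r - 2))⁻¹ := by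
    rw [one_div, Real.inv_rpow (by norm_num)]
  rw [h3]
  calc ((2 : ℝ) ^ (r - 2))⁻¹ ≤ (1 + (r - 2) / 2)⁻¹ := by gcongr
    _ = 1 - (r - 2) / r := by
      have : r ≠ 0 := by linarith
      have h4 : 1 + (r - 2) / 2 = r / 2 := by ring
      rw [h4]
      field_simp
      ring

/-- Summation over dyadic scales of quantities `I θ` with `θ² I θ ≤ E`. -/
theorem tsum_dyadic_le {r D : ℝ} (hr : 2 < r) (hD : 0 < D) {I : ℝ → ℝ≥0∞} {E : ℝ≥0∞}
    (hI : ∀ θ, 0 < θ → ENNReal.ofReal (θ ^ 2) * I θ ≤ E) :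
    ∑' k : ℕ, ENNReal.ofReal ((D * (1 / 2) ^ k) ^ r) * I (D * (1 / 2) ^ k / 4) ≤
      ENNReal.ofReal (16 * D ^ (r - 2) * (r / (r - 2))) * E := by
  set ρ : ℝ := (1 / 2) ^ (r - 2) with hρ
  have hρ0 : 0 ≤ ρ := by positivity
  have hρ1 : (r - 2) / r ≤ 1 - ρ := by linarith [one_half_rpow_le hr]
  have hr0 : 0 < (r - 2) / r := div_pos (by linarith) (by linarith)
  have hterm : ∀ k : ℕ, ENNReal.ofReal ((D * (1 / 2) ^ k) ^ r) * I (D * (1 / 2) ^ k / 4) ≤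
      ENNReal.ofReal (16 * D ^ (r - 2)) * E * ENNReal.ofReal ρ ^ k := by
    intro k
    have hx : 0 < D * (1 / 2) ^ k := by positivity
    have hsplit : (D * (1 / 2) ^ k) ^ r =
        16 * D ^ (r - 2) * ρ ^ k * (D * (1 / 2) ^ k / 4) ^ 2 := by
      have h1 : (D * (1 / 2) ^ k) ^ r = (D * (1 / 2) ^ k) ^ (r - 2) * (D * (1 / 2) ^ k) ^ 2 := by
        rw [← Real.rpow_natCast _ 2, ← Real.rpow_add hx]
        norm_num
      have h2 : (D * (1 / 2) ^ k) ^ (r - 2) = D ^ (r - 2) * ρ ^ k := by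
        rw [Real.mul_rpow hD.le (by positivity), hρ, ← Real.rpow_natCast, ← Real.rpow_natCast,
          ← Real.rpow_mul (by norm_num), ← Real.rpow_mul (by norm_num), mul_comm (k : ℝ)]
      rw [h1, h2]
      ring
    rw [hsplit, ENNReal.ofReal_mul (by positivity), ENNReal.ofReal_mul (by positivity),
      ENNReal.ofReal_pow hρ0, mul_assoc, mul_assoc (ENNReal.ofReal _) E, mul_assoc,
      mul_comm E]
    gcongr
    exact hI _ (by positivity)
  calc _ ≤ ∑' k : ℕ, ENNReal.ofReal (16 * D ^ (r - 2)) * E * ENNReal.ofReal ρ ^ k :=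
        ENNReal.tsum_le_tsum hterm
    _ = ENNReal.ofReal (16 * D ^ (r - 2)) * E * (1 - ENNReal.ofReal ρ)⁻¹ := by
        rw [ENNReal.tsum_mul_left, ENNReal.tsum_geometric]
    _ ≤ ENNReal.ofReal (16 * D ^ (r - 2)) * E * ENNReal.ofReal (r / (r - 2)) := by
        gcongr
        rw [← ENNReal.ofReal_one, ← ENNReal.ofReal_sub _ hρ0,
          ← ENNReal.ofReal_inv_of_pos (hr0.trans_le hρ1), ← inv_div (r - 2) r]
        gcongr
    _ = _ := by
        rw [ENNReal.ofReal_mul (by positivity : 0 ≤ 16 * D ^ (r - 2))]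
        ring

end RealEstimates

/-! ### The good-`λ` inequality on a finite window -/

section Window

variable {𝕜 X : Type*} [RCLike 𝕜] {mX : MeasurableSpace X} {ν : Measure X} {F : Filtration ℕ mX}

theorem measurable_resetEnergy {d : ℕ → X → 𝕜} (r D : ℝ)
    (hd : ∀ k, StronglyMeasurable[F (k + 1)] (d k)) (s : Finset ℕ) :
    Measurable fun x => resetEnergy r D (fun i => d i x) s :=
  Measurable.tsum fun _ => (Finset.measurable_fun_sum _ fun i _ =>
    measurable_resetIndicator _ hd i).const_mul _

theorem lintegral_resetEnergy_le [SigmaFiniteFiltration ν F] {r D : ℝ} (hr : 2 < r) (hD : 0 < D)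
    {d : ℕ → X → 𝕜}
    (hd : ∀ k, StronglyMeasurable[F (k + 1)] (d k)) (hd1 : ∀ k, Integrable (d k) ν)
    (hd2 : ∀ k, MemLp (d k) 2 ν)
    (hd0 : ∀ k A, MeasurableSet[F k] A → ν A < ∞ → ∫ x in A, d k x ∂ν = 0) (K : ℕ) :
    ∫⁻ x, resetEnergy r D (fun i => d i x) (Finset.range K) ∂ν ≤
      ENNReal.ofReal (16 * D ^ (r - 2) * (r / (r - 2))) *
        ∑ k ∈ Finset.range K, ∫⁻ x, ‖d k x‖ₑ ^ 2 ∂ν := by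
  have hm : ∀ θ, Measurable fun x =>
      ∑ k ∈ Finset.range K, resetIndicator θ (fun i => d i x) k := fun θ =>
    Finset.measurable_fun_sum _ fun i _ => measurable_resetIndicator _ hd i
  simp only [resetEnergy]
  rw [lintegral_tsum fun k => ((hm _).const_mul _).aemeasurable]
  simp_rw [lintegral_const_mul _ (hm _)]
  exact tsum_dyadic_le hr hD
    (I := fun θ => ∫⁻ x, ∑ k ∈ Finset.range K, resetIndicator θ (fun i => d i x) k ∂ν)
    fun θ hθ => lintegral_sum_resetIndicator_le hθ.le hd hd1 hd2 hd0 K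

/-- The predictable quadratic variation `∑_{k < n} E[|f_{k+1} - f_k|² | F_k]`. -/
noncomputable def condQuadVar (ν : Measure X) (F : Filtration ℕ mX) (f : ℕ → X → 𝕜) (n : ℕ)
    (x : X) : ℝ≥0∞ :=
  ∑ k ∈ Finset.range n, condLExp (F k) ν (fun y => ‖f (k + 1) y - f k y‖ₑ ^ 2) x

/-- Predictability: the term for the step from `n` to `n + 1` is already known at time `n`, so
`activeSet` may test it before the step is taken. -/
theorem measurable_condQuadVar (ν : Measure X) (F : Filtration ℕ mX) (f : ℕ → X → 𝕜) (n : ℕ) :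
    Measurable[F n] (condQuadVar ν F f (n + 1)) :=
  Finset.measurable_fun_sum _ fun _ hk => (measurable_condLExp _ _ _).mono
    (F.mono (Nat.lt_succ_iff.1 (Finset.mem_range.1 hk))) le_rfl

/-- The terms of a series added as long as the partial sums do not exceed `A` sum up to at most
`A`. -/
theorem sum_ite_partialSum_le (c : ℕ → ℝ≥0∞) (A : ℝ≥0∞) (K : ℕ) :
    ∑ k ∈ Finset.range K, (if ∑ i ∈ Finset.range (k + 1), c i ≤ A then c k else 0) ≤ A := by
  induction K with
  | zero => simp
  | succ K ih =>
    by_cases h : ∑ i ∈ Finset.range (K + 1), c i ≤ A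
    · refine le_trans (Finset.sum_le_sum fun k _ => ?_) h
      split_ifs <;> simp
    · rw [Finset.sum_range_succ, if_neg h, add_zero]
      exact ih

/-- The set of points at which the `r`-variation up to time `k < K` exceeds `l` while the
predictable quadratic variation up to time `k + 1` does not exceed `A`. -/
def activeSet (ν : Measure X) (F : Filtration ℕ mX) (f : ℕ → X → 𝕜) (r l : ℝ) (A : ℝ≥0∞)
    (K k : ℕ) : Set X :=
  {x | (k < K ∧ ENNReal.ofReal (l ^ r) < powVar r (fun i => f i x) k) ∧
    condQuadVar ν F f (k + 1) x ≤ A}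

theorem measurableSet_activeSet {f : ℕ → X → 𝕜} (hf : ∀ n, StronglyMeasurable[F n] (f n))
    (r l : ℝ) (A : ℝ≥0∞) (K k : ℕ) : MeasurableSet[F k] (activeSet ν F f r l A K k) :=
  ((MeasurableSet.const _).inter
    (measurableSet_lt measurable_const (measurable_powVar F r hf k))).inter
    (measurableSet_le (measurable_condQuadVar ν F f k) measurable_const)

theorem activeSet_subset (f : ℕ → X → 𝕜) (r l : ℝ) (A : ℝ≥0∞) (K k : ℕ) :
    activeSet ν F f r l A K k ⊆ {x | ENNReal.ofReal (l ^ r) < powVar r (fun i => f i x) K} :=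
  fun _ hx => hx.1.2.trans_le (powVar_mono r _ hx.1.1.le)

/-- Each active set is known at time `k`, so squared increments may be replaced by their conditional
expectations. These sum pointwise to at most `A`, without overshoot, and vanish off the set where
the variation exceeds `l`. -/
theorem sum_lintegral_activeSet_le [SigmaFiniteFiltration ν F] {f : ℕ → X → 𝕜}
    (hf : ∀ n, StronglyMeasurable[F n] (f n)) (r l : ℝ) (A : ℝ≥0∞) (K : ℕ) :
    ∑ k ∈ Finset.range K,
        ∫⁻ x in activeSet ν F f r l A K k, ‖f (k + 1) x - f k x‖ₑ ^ 2 ∂ν ≤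
      A * ν {x | ENNReal.ofReal (l ^ r) < powVar r (fun i => f i x) K} := by
  set T := {x | ENNReal.ofReal (l ^ r) < powVar r (fun i => f i x) K}
  have hTm : MeasurableSet T := measurableSet_lt measurable_const
    ((measurable_powVar F r hf K).mono (F.le K) le_rfl)
  set c : ℕ → X → ℝ≥0∞ := fun k => condLExp (F k) ν (fun y => ‖f (k + 1) y - f k y‖ₑ ^ 2)
  have hQ := fun k => measurableSet_activeSet (ν := ν) hf r l A K k
  have hc : ∀ k, Measurable (c k) := fun k => measurable_condLExp' _ _ _
  calc _ = ∑ k ∈ Finset.range K, ∫⁻ x, (activeSet ν F f r l A K k).indicator (c k) x ∂ν := by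
        refine Finset.sum_congr rfl fun k _ => ?_
        rw [lintegral_indicator (F.le k _ (hQ k))]
        exact (setLIntegral_condLExp (F.le k) ν _ (hQ k)).symm
    _ = ∫⁻ x, ∑ k ∈ Finset.range K, (activeSet ν F f r l A K k).indicator (c k) x ∂ν :=
        (lintegral_finsetSum _ fun k _ => (hc k).indicator (F.le k _ (hQ k))).symm
    _ ≤ ∫⁻ x, T.indicator (fun _ => A) x ∂ν := by
        refine lintegral_mono fun x => ?_
        by_cases hx : x ∈ T
        · rw [Set.indicator_of_mem hx]
          refine le_trans (Finset.sum_le_sum fun k _ => ?_)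
            (sum_ite_partialSum_le (fun k => c k x) A K)
          by_cases hk : x ∈ activeSet ν F f r l A K k
          · rw [Set.indicator_of_mem hk]
            exact (if_pos hk.2).ge
          · rw [Set.indicator_of_notMem hk]
            exact zero_le
        · rw [Set.indicator_of_notMem hx]
          refine (Finset.sum_eq_zero fun k _ => Set.indicator_of_notMem ?_ _).le
          exact fun h => hx (activeSet_subset f r l A K k h)
    _ = _ := lintegral_indicator_const hTm A

/-- The good-`λ` inequality for the variation over a finite window. -/
theorem measure_powVar_le [SigmaFiniteFiltration ν F] {f : ℕ → X → 𝕜}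
    (hf : ∀ n, StronglyMeasurable[F n] (f n))
    (hint : ∀ n A, MeasurableSet[F n] A → ν A < ∞ → IntegrableOn (f n) A ν)
    (hmart : ∀ n A, MeasurableSet[F n] A → ν A < ∞ →
      ∫ x in A, f (n + 1) x ∂ν = ∫ x in A, f n x ∂ν)
    {δ r l : ℝ} (hδ : 0 < δ) (hδ2 : δ < 1 / 2) (hr : 2 < r) (hl : 0 < l) (K : ℕ) :
    ν {x | ENNReal.ofReal ((3 * l) ^ r) < powVar r (fun i => f i x) K ∧
        (∀ k ≤ K, ‖f k x‖ ≤ δ * l) ∧ condQuadVar ν F f K x ≤ ENNReal.ofReal ((δ * l) ^ 2)} ≤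
      ENNReal.ofReal (16 * δ ^ 2 / (r - 2) ^ 2) *
        ν {x | ENNReal.ofReal (l ^ r) < powVar r (fun i => f i x) K} := by
  have hr2 : 0 < r - 2 := by linarith
  have hr0 : 0 < r := by linarith
  set T := {x | ENNReal.ofReal (l ^ r) < powVar r (fun i => f i x) K}
  set A := ENNReal.ofReal ((δ * l) ^ 2) with hA
  set E := {x | ENNReal.ofReal ((3 * l) ^ r) < powVar r (fun i => f i x) K ∧
        (∀ k ≤ K, ‖f k x‖ ≤ δ * l) ∧ condQuadVar ν F f K x ≤ A}
  -- If `ν T = ∞` the claim is trivial; otherwise the active sets have finite measure and the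
  -- truncated differences are in `L¹` and `L²`.
  rcases eq_or_ne (ν T) ∞ with hTtop | hTtop
  · rw [hTtop, ENNReal.mul_top]
    · exact le_top
    · exact (ENNReal.ofReal_pos.2 (by positivity)).ne'
  set Q := activeSet ν F f r l A K
  have hQ : ∀ k, MeasurableSet[F k] (Q k) := measurableSet_activeSet hf r l A K
  have hQfin : ∀ k, ν (Q k) < ∞ := fun k =>
    (measure_mono (activeSet_subset f r l A K k)).trans_lt hTtop.lt_top
  set d : ℕ → X → 𝕜 := fun k => (Q k).indicator fun x => f (k + 1) x - f k x with hd
  have hdm : ∀ k, StronglyMeasurable[F (k + 1)] (d k) := fun k =>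
    ((hf (k + 1)).sub ((hf k).mono (F.mono k.le_succ))).indicator (F.mono k.le_succ _ (hQ k))
  have hint' : ∀ k B, MeasurableSet[F k] B → ν B < ∞ → IntegrableOn (f (k + 1)) B ν :=
    fun k B hB => hint (k + 1) B (F.mono k.le_succ _ hB)
  have hd1 : ∀ k, Integrable (d k) ν := fun k =>
    (integrable_indicator_iff (F.le k _ (hQ k))).2
      ((hint' k _ (hQ k) (hQfin k)).sub (hint k _ (hQ k) (hQfin k)))
  have henergy : ∀ k, ∫⁻ x, ‖d k x‖ₑ ^ 2 ∂ν = ∫⁻ x in Q k, ‖f (k + 1) x - f k x‖ₑ ^ 2 ∂ν := by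
    intro k
    rw [← lintegral_indicator (F.le k _ (hQ k))]
    congr with x
    by_cases hx : x ∈ Q k <;> simp [hd, hx]
  have hsum : ∑ k ∈ Finset.range K, ∫⁻ x, ‖d k x‖ₑ ^ 2 ∂ν ≤ A * ν T := by
    simp_rw [henergy]
    exact sum_lintegral_activeSet_le hf r l A K
  have hd2 : ∀ k, MemLp (d k) 2 ν := by
    intro k
    rw [memLp_two_iff_lintegral_enorm_sq_lt_top (hd1 k).aestronglyMeasurable]
    by_cases hk : k < K
    · refine lt_of_le_of_lt ?_ (ENNReal.mul_lt_top (a := A) ENNReal.ofReal_lt_top hTtop.lt_top)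
      exact (Finset.single_le_sum (f := fun k => ∫⁻ x, ‖d k x‖ₑ ^ 2 ∂ν)
        (fun _ _ => zero_le) (Finset.mem_range.2 hk)).trans hsum
    · have : Q k = ∅ := Set.eq_empty_of_forall_notMem fun x hx => hk hx.1.1
      simp [henergy, this]
  have hd0 : ∀ k B, MeasurableSet[F k] B → ν B < ∞ → ∫ x in B, d k x ∂ν = 0 := by
    intro k B hB hBfin
    have hBQ : MeasurableSet[F k] (B ∩ Q k) := hB.inter (hQ k)
    have hfin : ν (B ∩ Q k) < ∞ := (measure_mono Set.inter_subset_left).trans_lt hBfin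
    rw [hd, setIntegral_indicator (F.le k _ (hQ k)),
      integral_sub (hint' k _ hBQ hfin) (hint k _ hBQ hfin), hmart k _ hBQ hfin, sub_self]
  -- `D` bounds the oscillation of `f` where `|f| ≤ δ l`, and `δ < 1/2` makes it at most `l`.
  set D := 2 * δ * l with hD
  have hD0 : 0 < D := by positivity
  have hDl : D ≤ l := by nlinarith
  have hpoint : E ⊆ {x | ENNReal.ofReal (r ^ 2 * l ^ r) ≤
      resetEnergy r D (fun i => d i x) (Finset.range K)} := by
    rintro x ⟨hx1, hx2, hx3⟩
    have hxT : ENNReal.ofReal (l ^ r) < powVar r (fun i => f i x) K := by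
      refine lt_of_le_of_lt (ENNReal.ofReal_le_ofReal ?_) hx1
      gcongr
      linarith
    classical
    have hex : ∃ n, ENNReal.ofReal (l ^ r) < powVar r (fun i => f i x) n := ⟨K, hxT⟩
    set τ := Nat.find hex
    have hτspec : ENNReal.ofReal (l ^ r) < powVar r (fun i => f i x) τ := Nat.find_spec hex
    have hτ1 : 1 ≤ τ := by
      by_contra h
      have h0 : τ = 0 := by omega
      rw [h0, powVar_zero hr0] at hτspec
      exact not_lt_zero hτspec
    have hτK : τ ≤ K := Nat.find_min' hex hxT
    have hbefore : powVar r (fun i => f i x) (τ - 1) ≤ ENNReal.ofReal (l ^ r) :=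
      not_lt.1 (Nat.find_min hex (by omega : τ - 1 < τ))
    have hle := powVar_le_resetEnergy (r := r) (D := D) (f := fun i => f i x)
      (d := fun i => d i x) hr0 hD0 hτ1 hτK
      (fun i hi j hj => by
        have := norm_sub_le (f i x) (f j x)
        linarith [hx2 i hi, hx2 j hj])
      (fun k hk hkK => by
        have hmem : x ∈ Q k := by
          refine ⟨⟨hkK, hτspec.trans_le (powVar_mono r _ hk)⟩, le_trans ?_ hx3⟩
          exact Finset.sum_le_sum_of_subset (Finset.range_mono hkK)
        simp [hd, hmem])
    have hDr : ENNReal.ofReal D ^ r ≤ ENNReal.ofReal (l ^ r) := by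
      rw [ENNReal.ofReal_rpow_of_nonneg hD0.le hr0.le]
      gcongr
    by_contra hlt
    rw [Set.mem_ofPred_eq, not_le] at hlt
    have hlt' := hx1.trans_le (hle.trans
      (add_le_add (add_le_add hbefore hDr) hlt.le))
    rw [← ENNReal.ofReal_add (by positivity) (by positivity),
      ← ENNReal.ofReal_add (by positivity) (by positivity),
      ENNReal.ofReal_lt_ofReal_iff_of_nonneg (by positivity),
      Real.mul_rpow (by norm_num) hl.le] at hlt'
    nlinarith [sq_add_two_le_three_rpow hr, Real.rpow_pos_of_pos hl r]
  have hcheb : ENNReal.ofReal (r ^ 2 * l ^ r) * ν E ≤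
      ENNReal.ofReal (16 * D ^ (r - 2) * (r / (r - 2))) * (A * ν T) := by
    calc _ ≤ ENNReal.ofReal (r ^ 2 * l ^ r) * ν {x | ENNReal.ofReal (r ^ 2 * l ^ r) ≤
            resetEnergy r D (fun i => d i x) (Finset.range K)} := by gcongr
      _ ≤ _ := mul_meas_ge_le_lintegral (measurable_resetEnergy r D hdm _) _
      _ ≤ _ := lintegral_resetEnergy_le hr hD0 hdm hd1 hd2 hd0 K
      _ ≤ _ := by gcongr
  -- The factor `r²` from the Chebyshev height offsets the `r` of the geometric series; the bound `r
  -- (r - 2) ≤ r²` then gives the stated form.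
  have hcoef : 16 * D ^ (r - 2) * (r / (r - 2)) * (δ * l) ^ 2 ≤
      r ^ 2 * l ^ r * (16 * δ ^ 2 / (r - 2) ^ 2) := by
    have hlr : l ^ r = l ^ (r - 2) * l ^ 2 := by
      rw [← Real.rpow_natCast l 2, ← Real.rpow_add hl]
      norm_num
    have hDr : D ^ (r - 2) ≤ l ^ (r - 2) := by gcongr
    calc _ ≤ 16 * l ^ (r - 2) * (r / (r - 2)) * (δ * l) ^ 2 := by gcongr
      _ = l ^ r * (16 * δ ^ 2 / (r - 2) ^ 2) * (r * (r - 2)) := by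
          rw [hlr]
          field_simp
      _ ≤ l ^ r * (16 * δ ^ 2 / (r - 2) ^ 2) * (r * r) := by
          gcongr
          linarith
      _ = _ := by ring
  have hpos : 0 < r ^ 2 * l ^ r := by positivity
  refine (ENNReal.mul_le_mul_iff_right (ENNReal.ofReal_pos.2 hpos).ne' ENNReal.ofReal_ne_top).1
    (hcheb.trans ?_)
  rw [← mul_assoc, ← mul_assoc, hA, ← ENNReal.ofReal_mul (by positivity),
    ← ENNReal.ofReal_mul hpos.le]
  gcongr

end Window

/-! ### From monotone to strictly monotone chains -/

section Chains

/-- The repetitions in a monotone chain may be removed without changing a sum over its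
increments. -/
theorem exists_strictMono_sum_eq {φ : ℤ → ℤ → ℝ≥0∞} (hφ : ∀ i, φ i i = 0) {J : ℕ}
    {u : Fin (J + 1) → ℤ} (hu : Monotone u) :
    ∃ (J' : ℕ) (n : Fin (J' + 1) → ℤ), StrictMono n ∧ n (Fin.last J') = u (Fin.last J) ∧
      ∑ j : Fin J', φ (n j.castSucc) (n j.succ) = ∑ j : Fin J, φ (u j.castSucc) (u j.succ) := by
  induction J with
  | zero => exact ⟨0, u, fun i j hij => by omega, rfl, rfl⟩
  | succ J ih =>
    obtain ⟨J', n, hn, hlast, hsum⟩ := ih (u := fun i => u i.castSucc) fun i j hij =>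
      hu (by simpa using hij)
    rw [Fin.sum_univ_castSucc]
    simp only [Fin.succ_castSucc, Fin.succ_last]
    rcases (hu (Fin.le_last (Fin.last J).castSucc)).eq_or_lt with h | h
    · refine ⟨J', n, hn, hlast.trans h, ?_⟩
      rw [hsum, h, hφ, add_zero]
    · refine ⟨J' + 1, Fin.snoc n (u (Fin.last (J + 1))), ?_, by simp, ?_⟩
      · rw [Fin.strictMono_iff_lt_succ]
        intro i
        refine Fin.lastCases ?_ (fun i => ?_) i
        · simpa [hlast] using h
        · rw [Fin.succ_castSucc, Fin.snoc_castSucc, Fin.snoc_castSucc]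
          exact hn (Fin.castSucc_lt_succ)
      · rw [Fin.sum_univ_castSucc]
        simp only [Fin.succ_castSucc, Fin.succ_last, Fin.snoc_castSucc, Fin.snoc_last]
        rw [hsum, hlast]

end Chains

/-! ### Exhausting `ℤ` by windows -/

section WindowVariation

variable {𝕜 X : Type*} [RCLike 𝕜]

/-- The `r`-variation over the window `[-N, N]`. -/
noncomputable def windowVariation (r : ℝ) (f : ℤ → X → 𝕜) (N : ℕ) (x : X) : ℝ≥0∞ :=
  powVar r (fun k => f (-N + k) x) (2 * N) ^ (1 / r)

theorem ofReal_lt_windowVariation_iff {r l : ℝ} (hr : 0 < r) (hl : 0 ≤ l) (f : ℤ → X → 𝕜) (N : ℕ)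
    (x : X) : ENNReal.ofReal l < windowVariation r f N x ↔
      ENNReal.ofReal (l ^ r) < powVar r (fun k => f (-N + k) x) (2 * N) := by
  rw [windowVariation, one_div, ENNReal.lt_rpow_inv_iff hr,
    ENNReal.ofReal_rpow_of_nonneg hl hr.le]

theorem windowVariation_le_variation {r : ℝ} (hr : 0 < r) (f : ℤ → X → 𝕜) (N : ℕ) (x : X) :
    windowVariation r f N x ≤ variation r f x := by
  rw [windowVariation, one_div, ENNReal.rpow_inv_le_iff hr]
  refine powVar_le fun J u hu _ => ?_
  have hv : Monotone fun i => (-N + u i : ℤ) := fun i j hij => by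
    have := hu hij
    simp only
    omega
  obtain ⟨J', n, hn, -, hsum⟩ := exists_strictMono_sum_eq
    (φ := fun i j => ‖f j x - f i x‖ₑ ^ r) (by simp [ENNReal.zero_rpow_of_pos hr]) hv
  rw [← hsum, ← ENNReal.rpow_inv_le_iff hr, ← one_div]
  exact le_iSup₂_of_le J' n (le_iSup_of_le hn le_rfl)

theorem windowVariation_mono {r : ℝ} (hr : 0 < r) (f : ℤ → X → 𝕜) (x : X) :
    Monotone fun N => windowVariation r f N x := by
  intro M N hMN
  refine ENNReal.rpow_le_rpow (powVar_le fun J u hu hM => ?_) (by positivity)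
  have := le_powVar r (fun k : ℕ => f (-N + k) x) (n := 2 * N) (u := fun i => u i + (N - M))
    (fun i j hij => Nat.add_le_add_right (hu hij) _) (fun i => by have := hM i; omega)
  refine le_trans (le_of_eq (Finset.sum_congr rfl fun j _ => ?_)) this
  have h : ∀ k : ℕ, (-N + (k + (N - M) : ℕ) : ℤ) = -M + k := fun k => by omega
  simp only [h]

theorem variation_eq_iSup_windowVariation {r : ℝ} (hr : 0 < r) (f : ℤ → X → 𝕜) (x : X) :
    variation r f x = ⨆ N, windowVariation r f N x := by
  refine le_antisymm (iSup₂_le fun J n => iSup_le fun hn => ?_)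
    (iSup_le fun N => windowVariation_le_variation hr f N x)
  -- Any window containing the chain would do; the sum of the absolute values is a convenient size.
  set N : ℕ := ∑ i, (n i).natAbs with hN
  have hbound : ∀ i, (n i).natAbs ≤ N := fun i =>
    Finset.single_le_sum (f := fun i => (n i).natAbs) (fun _ _ => Nat.zero_le _)
      (Finset.mem_univ i)
  have hcast : ∀ i, (-N + (n i + N).toNat : ℤ) = n i := fun i => by
    have := hbound i
    omega
  refine le_iSup_of_le N (ENNReal.rpow_le_rpow ?_ (by positivity))
  have := le_powVar r (fun k : ℕ => f (-N + k) x) (n := 2 * N) (u := fun i => (n i + N).toNat)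
    (fun i j hij => Int.toNat_le_toNat (by have := hn.monotone hij; omega))
    (fun i => by have := hbound i; omega)
  simpa only [hcast] using this

/-- The window variation is finite, with a bound by the maximal function that depends on the
window. -/
theorem windowVariation_le_maximalFunction {r : ℝ} (hr : 0 < r) (f : ℤ → X → 𝕜) (N : ℕ) (x : X) :
    windowVariation r f N x ≤
      ((2 * N : ℕ) : ℝ≥0∞) ^ (1 / r) * (2 * maximalFunction f x) := by
  have hM : ∀ n, ‖f n x‖ₑ ≤ maximalFunction f x := fun n => le_iSup (fun n => ‖f n x‖ₑ) n
  have hdiff : ∀ m n, ‖f m x - f n x‖ₑ ≤ 2 * maximalFunction f x := fun m n => by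
    rw [two_mul]
    exact enorm_sub_le.trans (add_le_add (hM m) (hM n))
  have : powVar r (fun k => f (-N + k) x) (2 * N) ≤
      ((2 * N : ℕ) : ℝ≥0∞) * (2 * maximalFunction f x) ^ r := by
    refine powVar_le fun J u hu hK => ?_
    calc _ ≤ ∑ j : Fin J, ∑ i ∈ Finset.Ico (u j.castSucc) (u j.succ),
          (2 * maximalFunction f x) ^ r := by
          refine Finset.sum_le_sum fun j _ => ?_
          rcases (hu (Fin.castSucc_le_succ j)).eq_or_lt with h | h
          · simp [h, ENNReal.zero_rpow_of_pos hr]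
          · refine le_trans ?_ (Finset.single_le_sum (fun _ _ => zero_le)
              (Finset.mem_Ico.2 ⟨le_rfl, h⟩))
            gcongr
            exact hdiff _ _
      _ = _ := sum_sum_Ico_eq hu
      _ ≤ ∑ i ∈ Finset.range (2 * N), (2 * maximalFunction f x) ^ r := by
          refine Finset.sum_le_sum_of_subset fun i hi => ?_
          exact Finset.mem_range.2 ((Finset.mem_Ico.1 hi).2.trans_le (hK _))
      _ = _ := by simp
  refine (ENNReal.rpow_le_rpow this (by positivity)).trans_eq ?_
  rw [ENNReal.mul_rpow_of_nonneg _ _ (by positivity), ← ENNReal.rpow_mul, mul_one_div_cancel hr.ne',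
    ENNReal.rpow_one]

end WindowVariation

/-! ### The good-`λ` inequality on `ℤ` -/

section GoodLambda

variable {𝕜 X : Type*} [RCLike 𝕜] {mX : MeasurableSpace X} {ν : Measure X} {ℱ : Filtration ℤ mX}

/-- The filtration `ℱ a, ℱ (a + 1), …`. -/
def filtrationFrom (ℱ : Filtration ℤ mX) (a : ℤ) : Filtration ℕ mX where
  seq k := ℱ (a + k)
  mono' i j hij := ℱ.mono (by omega)
  le' _ := ℱ.le _

instance (a : ℤ) [h : SigmaFiniteFiltration ν ℱ] :
    SigmaFiniteFiltration ν (filtrationFrom ℱ a) :=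
  ⟨fun k => h.SigmaFinite (a + (k : ℤ))⟩

theorem measurable_windowVariation {f : ℤ → X → 𝕜} (hf : IsMartingale ν ℱ f) (r : ℝ) (N : ℕ) :
    Measurable (windowVariation r f N) :=
  ((measurable_powVar (filtrationFrom ℱ (-N)) r (f := fun k => f (-N + k))
    (fun _ => hf.adapted _) (2 * N)).mono (Filtration.le _ _) le_rfl).pow_const _

theorem measurable_variation {f : ℤ → X → 𝕜} (hf : IsMartingale ν ℱ f) {r : ℝ} (hr : 0 < r) :
    Measurable (variation r f) := by
  rw [funext (variation_eq_iSup_windowVariation hr f)]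
  exact Measurable.iSup fun N => measurable_windowVariation hf r N

theorem condQuadVar_le_condSquareFunction_sq (ν : Measure X) (ℱ : Filtration ℤ mX)
    (f : ℤ → X → 𝕜) (a : ℤ) (K : ℕ) (x : X) :
    condQuadVar ν (filtrationFrom ℱ a) (fun k => f (a + k)) K x ≤
      condSquareFunction ν ℱ f x ^ 2 := by
  have hsq : condSquareFunction ν ℱ f x ^ 2 = ∑' n : ℤ,
      condLExp (ℱ (n - 1)) ν (fun y => ‖f n y - f (n - 1) y‖ₑ ^ 2) x := by
    rw [condSquareFunction, ← ENNReal.rpow_natCast, ← ENNReal.rpow_mul]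
    norm_num
  -- Step `k` of the shifted martingale is the difference with index `a + k + 1`, so the window
  -- collects distinct terms of the full series.
  have hinj : Function.Injective fun k : ℕ => a + k + 1 := fun i j hij => by
    simp only at hij
    omega
  rw [hsq]
  refine le_trans ?_ (ENNReal.tsum_comp_le_tsum_of_injective hinj _)
  refine le_trans (le_of_eq (Finset.sum_congr rfl fun k _ => ?_)) (ENNReal.sum_le_tsum _)
  simp only [add_sub_cancel_right, Nat.cast_add, Nat.cast_one, ← add_assoc]
  rfl

/-- The good-`λ` inequality for the variation over the window `[-N, N]`. -/
theorem measure_windowVariation_le [SigmaFiniteFiltration ν ℱ] {f : ℤ → X → 𝕜}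
    (hf : IsMartingale ν ℱ f) {δ r l : ℝ} (hδ : 0 < δ) (hδ2 : δ < 1 / 2) (hr : 2 < r)
    (hl : 0 < l) (N : ℕ) :
    ν {x | ENNReal.ofReal (3 * l) < windowVariation r f N x ∧
        maximalFunction f x ≤ ENNReal.ofReal (δ * l)} ≤
      ν {x | ENNReal.ofReal (δ * l) < condSquareFunction ν ℱ f x} +
        ENNReal.ofReal (16 * δ ^ 2 / (r - 2) ^ 2) *
          ν {x | ENNReal.ofReal l < windowVariation r f N x} := by
  have hr0 : 0 < r := by linarith
  have key := measure_powVar_le (ν := ν) (F := filtrationFrom ℱ (-N))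
    (f := fun k => f (-N + k)) (fun _ => hf.adapted _) (fun _ => hf.integrableOn _)
    (fun k A hA hA' => hf.setIntegral_eq (-N + k) (-N + (k + 1 : ℕ)) (by omega) A hA hA')
    hδ hδ2 hr hl (2 * N)
  simp_rw [ofReal_lt_windowVariation_iff hr0 hl.le f N,
    ofReal_lt_windowVariation_iff hr0 (by positivity : 0 ≤ 3 * l) f N]
  refine le_trans (measure_mono ?_) ((measure_union_le _ _).trans (add_le_add_right key _))
  rintro x ⟨hx1, hx2⟩
  by_cases hs : ENNReal.ofReal (δ * l) < condSquareFunction ν ℱ f x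
  · exact Or.inl hs
  · refine Or.inr ⟨hx1, fun k _ => ?_, ?_⟩
    · have : ‖f (-N + k) x‖ₑ ≤ ENNReal.ofReal (δ * l) :=
        (le_iSup (fun n => ‖f n x‖ₑ) _).trans hx2
      rwa [← ofReal_norm, ENNReal.ofReal_le_ofReal_iff (by positivity)] at this
    · refine (condQuadVar_le_condSquareFunction_sq ν ℱ f _ _ x).trans ?_
      rw [ENNReal.ofReal_pow (by positivity)]
      exact pow_le_pow_left' (not_lt.1 hs) 2

/-- The good-`λ` inequality for the variation. -/
theorem measure_variation_le [SigmaFiniteFiltration ν ℱ] {f : ℤ → X → 𝕜}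
    (hf : IsMartingale ν ℱ f) {δ r l : ℝ} (hδ : 0 < δ) (hδ2 : δ < 1 / 2) (hr : 2 < r)
    (hl : 0 < l) :
    ν {x | ENNReal.ofReal (3 * l) < variation r f x ∧
        maximalFunction f x ≤ ENNReal.ofReal (δ * l)} ≤
      ν {x | ENNReal.ofReal (δ * l) < condSquareFunction ν ℱ f x} +
        ENNReal.ofReal (16 * δ ^ 2 / (r - 2) ^ 2) *
          ν {x | ENNReal.ofReal l < variation r f x} := by
  have hr0 : 0 < r := by linarith
  have hunion : {x | ENNReal.ofReal (3 * l) < variation r f x ∧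
      maximalFunction f x ≤ ENNReal.ofReal (δ * l)} =
      ⋃ N, {x | ENNReal.ofReal (3 * l) < windowVariation r f N x ∧
        maximalFunction f x ≤ ENNReal.ofReal (δ * l)} := by
    ext x
    simp [variation_eq_iSup_windowVariation hr0, lt_iSup_iff]
  have hmono : Monotone fun N => {x | ENNReal.ofReal (3 * l) < windowVariation r f N x ∧
      maximalFunction f x ≤ ENNReal.ofReal (δ * l)} := fun M N hMN x hx =>
    ⟨hx.1.trans_le (windowVariation_mono hr0 f x hMN), hx.2⟩
  rw [hunion, hmono.measure_iUnion]
  refine iSup_le fun N => (measure_windowVariation_le hf hδ hδ2 hr hl N).trans ?_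
  gcongr
  exact windowVariation_le_variation hr0 f N _

end GoodLambda

/-! ### Integrating a good-`λ` inequality -/

section LayerCake

variable {X : Type*} {mX : MeasurableSpace X} {ν : Measure X}

/-- The layer cake formula for functions with values in `[0, ∞]`, with a scaling factor. -/
theorem ofReal_rpow_mul_lintegral_rpow_eq {g : X → ℝ≥0∞} (hg : AEMeasurable g ν)
    (hfin : ∀ᵐ x ∂ν, g x ≠ ∞) {p c : ℝ} (hp : 0 < p) (hc : 0 < c) :
    ENNReal.ofReal (c ^ (-p)) * ∫⁻ x, g x ^ p ∂ν =
      ENNReal.ofReal p * ∫⁻ t in Set.Ioi (0 : ℝ),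
        ν {x | ENNReal.ofReal (c * t) < g x} * ENNReal.ofReal (t ^ (p - 1)) := by
  have h := lintegral_rpow_eq_lintegral_meas_lt_mul ν (f := fun x => (g x).toReal / c)
    (ae_of_all _ fun x => by positivity) (hg.ennreal_toReal.div_const c) hp
  have hleft : ∫⁻ x, ENNReal.ofReal (((g x).toReal / c) ^ p) ∂ν =
      ENNReal.ofReal (c ^ (-p)) * ∫⁻ x, g x ^ p ∂ν := by
    rw [← lintegral_const_mul' _ _ ENNReal.ofReal_ne_top]
    refine lintegral_congr_ae ?_
    filter_upwards [hfin] with x hx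
    rw [div_eq_mul_inv, mul_comm, Real.mul_rpow (by positivity) (by positivity),
      ENNReal.ofReal_mul (by positivity), Real.inv_rpow hc.le, ← Real.rpow_neg hc.le,
      ← ENNReal.ofReal_rpow_of_nonneg ENNReal.toReal_nonneg hp.le, ENNReal.ofReal_toReal hx]
  rw [← hleft, h]
  congr 1
  refine setLIntegral_congr_fun measurableSet_Ioi fun t ht => ?_
  have ht : 0 < t := ht
  congr 1
  refine measure_congr ?_
  filter_upwards [hfin] with x hx
  refine propext ?_
  change t < (g x).toReal / c ↔ ENNReal.ofReal (c * t) < g x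
  rw [ENNReal.ofReal_lt_iff_lt_toReal (by positivity) hx, lt_div_iff₀ hc, mul_comm]

theorem antitone_measure_ofReal_mul_lt {c : ℝ} (hc : 0 ≤ c) (g : X → ℝ≥0∞) :
    Antitone fun t : ℝ => ν {x | ENNReal.ofReal (c * t) < g x} := fun s t hst =>
  measure_mono fun x hx => lt_of_le_of_lt (ENNReal.ofReal_le_ofReal (by gcongr)) hx

/-- Integration of a good-`λ` inequality. -/
theorem lintegral_rpow_le_of_measure_le {W M s : X → ℝ≥0∞} (hW : AEMeasurable W ν)
    (hM : AEMeasurable M ν) (hs : AEMeasurable s ν) (hMfin : ∀ᵐ x ∂ν, M x ≠ ∞)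
    (hsfin : ∀ᵐ x ∂ν, s x ≠ ∞) (hWfin : ∀ᵐ x ∂ν, W x ≠ ∞) {p δ κ : ℝ}
    (hp : 0 < p) (hδ : 0 < δ) (hκ : κ ≤ (3 : ℝ) ^ (-p) / 2) (hWp : ∫⁻ x, W x ^ p ∂ν ≠ ∞)
    (h : ∀ t, 0 < t → ν {x | ENNReal.ofReal (3 * t) < W x} ≤
      ν {x | ENNReal.ofReal (δ * t) < M x} + ν {x | ENNReal.ofReal (δ * t) < s x} +
        ENNReal.ofReal κ * ν {x | ENNReal.ofReal (1 * t) < W x}) :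
    ENNReal.ofReal ((3 : ℝ) ^ (-p) / 2) * ∫⁻ x, W x ^ p ∂ν ≤
      ENNReal.ofReal (δ ^ (-p)) * (∫⁻ x, M x ^ p ∂ν + ∫⁻ x, s x ^ p ∂ν) := by
  set w : ℝ → ℝ≥0∞ := fun t => ENNReal.ofReal (t ^ (p - 1)) with hw
  have hwm : Measurable w := by fun_prop
  have hmeas : ∀ (c : ℝ) (g : X → ℝ≥0∞), 0 ≤ c →
      Measurable fun t : ℝ => ν {x | ENNReal.ofReal (c * t) < g x} * w t := fun c g hc =>
    (antitone_measure_ofReal_mul_lt hc g).measurable.mul hwm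
  have hmain : ENNReal.ofReal ((3 : ℝ) ^ (-p)) * ∫⁻ x, W x ^ p ∂ν ≤
      ENNReal.ofReal (δ ^ (-p)) * (∫⁻ x, M x ^ p ∂ν + ∫⁻ x, s x ^ p ∂ν) +
        ENNReal.ofReal κ * ∫⁻ x, W x ^ p ∂ν := by
    have hone : ∫⁻ x, W x ^ p ∂ν = ENNReal.ofReal ((1 : ℝ) ^ (-p)) * ∫⁻ x, W x ^ p ∂ν := by simp
    nth_rewrite 2 [hone]
    rw [mul_add, ofReal_rpow_mul_lintegral_rpow_eq hW hWfin hp (by norm_num),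
      ofReal_rpow_mul_lintegral_rpow_eq hW hWfin hp one_pos,
      ofReal_rpow_mul_lintegral_rpow_eq hM hMfin hp hδ,
      ofReal_rpow_mul_lintegral_rpow_eq hs hsfin hp hδ, mul_left_comm, ← mul_add, ← mul_add]
    gcongr
    rw [← lintegral_const_mul _ (hmeas 1 W zero_le_one), ← lintegral_add_left (hmeas δ M hδ.le),
      ← lintegral_add_right _ ((hmeas 1 W zero_le_one).const_mul _)]
    refine setLIntegral_mono' measurableSet_Ioi fun t ht => ?_
    calc _ ≤ (ν {x | ENNReal.ofReal (δ * t) < M x} + ν {x | ENNReal.ofReal (δ * t) < s x} +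
        ENNReal.ofReal κ * ν {x | ENNReal.ofReal (1 * t) < W x}) * w t := by
          gcongr
          exact h t ht
      _ = _ := by
          simp only [hw]
          ring
  -- Half of the left side absorbs the `κ` term; the cancellation needs `∫ W^p` finite.
  have hsplit : ENNReal.ofReal ((3 : ℝ) ^ (-p)) =
      ENNReal.ofReal ((3 : ℝ) ^ (-p) / 2) + ENNReal.ofReal ((3 : ℝ) ^ (-p) / 2) := by
    rw [← ENNReal.ofReal_add (by positivity) (by positivity), add_halves]
  rw [hsplit, add_mul] at hmain
  refine (ENNReal.add_le_add_iff_right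
    (ENNReal.mul_ne_top ENNReal.ofReal_ne_top hWp)).1 (hmain.trans ?_)
  gcongr

theorem memLp_ofReal_iff {g : X → ℝ≥0∞} {p : ℝ} (hp : 0 < p) :
    MemLp g (ENNReal.ofReal p) ν ↔ AEStronglyMeasurable g ν ∧ ∫⁻ x, g x ^ p ∂ν < ∞ := by
  rw [MemLp, eLpNorm_lt_top_iff_lintegral_rpow_enorm_lt_top (by simpa using hp)
    ENNReal.ofReal_ne_top, ENNReal.toReal_ofReal hp.le]
  simp

theorem ae_ne_top_of_lintegral_rpow_lt_top {g : X → ℝ≥0∞} {p : ℝ} (hp : 0 < p)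
    (hg : AEMeasurable g ν) (h : ∫⁻ x, g x ^ p ∂ν < ∞) : ∀ᵐ x ∂ν, g x ≠ ∞ := by
  filter_upwards [ae_lt_top' (hg.pow_const p) h.ne] with x hx hx'
  simp [hx', ENNReal.top_rpow_of_pos hp] at hx

end LayerCake

/-! ### The `L^p` bound -/

section Lp

variable {𝕜 X : Type*} [RCLike 𝕜] {mX : MeasurableSpace X} {ν : Measure X} {ℱ : Filtration ℤ mX}

theorem memLp_variation [SigmaFiniteFiltration ν ℱ] {f : ℤ → X → 𝕜} (hf : IsMartingale ν ℱ f)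
    {p r : ℝ} (hp : 0 < p) (hr : 2 < r)
    (hs : MemLp (condSquareFunction ν ℱ f) (ENNReal.ofReal p) ν)
    (hM : MemLp (maximalFunction f) (ENNReal.ofReal p) ν) :
    MemLp (variation r f) (ENNReal.ofReal p) ν := by
  have hr0 : 0 < r := by linarith
  have hr2 : 0 < r - 2 := by linarith
  rw [memLp_ofReal_iff hp] at hs hM ⊢
  refine ⟨(measurable_variation hf hr0).aestronglyMeasurable, ?_⟩
  have hMfin := ae_ne_top_of_lintegral_rpow_lt_top hp hM.1.aemeasurable hM.2
  have hsfin := ae_ne_top_of_lintegral_rpow_lt_top hp hs.1.aemeasurable hs.2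
  set q : ℝ := (3 : ℝ) ^ (-p) / 2 with hq
  have hq0 : 0 < q := by positivity
  -- The square root makes the good-`λ` factor `16 δ² / (r - 2)²` at most `q`, as absorption
  -- demands; `1 / 4` keeps `δ` below `1 / 2`.
  set δ : ℝ := min (1 / 4) (Real.sqrt (q * (r - 2) ^ 2 / 16)) with hδdef
  have hδ : 0 < δ := lt_min (by norm_num) (Real.sqrt_pos.2 (by positivity))
  have hδ2 : δ < 1 / 2 := (min_le_left _ _).trans_lt (by norm_num)
  have hκ : 16 * δ ^ 2 / (r - 2) ^ 2 ≤ q := by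
    have := (Real.le_sqrt' hδ).1 (min_le_right (1 / 4) (Real.sqrt (q * (r - 2) ^ 2 / 16)))
    rw [div_le_iff₀ (by positivity)]
    linarith
  have hbound : ∀ N, ∫⁻ x, windowVariation r f N x ^ p ∂ν ≤ ENNReal.ofReal (δ ^ (-p)) *
      (∫⁻ x, maximalFunction f x ^ p ∂ν + ∫⁻ x, condSquareFunction ν ℱ f x ^ p ∂ν) /
        ENNReal.ofReal q := by
    intro N
    have hWm := measurable_windowVariation hf r N
    have hWle := windowVariation_le_maximalFunction hr0 f N
    -- This bound depends on `N` and serves only to license the absorption; the resulting estimate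
    -- is uniform in `N`.
    have hWp : ∫⁻ x, windowVariation r f N x ^ p ∂ν < ∞ := by
      set c : ℝ≥0∞ := ((2 * N : ℕ) : ℝ≥0∞) ^ (1 / r) * 2 with hc
      have hctop : c ≠ ∞ := ENNReal.mul_ne_top
        (ENNReal.rpow_ne_top_of_nonneg (by positivity) (ENNReal.natCast_ne_top _))
        ENNReal.ofNat_ne_top
      calc _ ≤ ∫⁻ x, c ^ p * maximalFunction f x ^ p ∂ν := by
            refine lintegral_mono fun x => ?_
            rw [← ENNReal.mul_rpow_of_nonneg _ _ hp.le]
            gcongr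
            rw [hc, mul_assoc]
            exact hWle x
        _ = c ^ p * ∫⁻ x, maximalFunction f x ^ p ∂ν :=
            lintegral_const_mul' _ _ (ENNReal.rpow_ne_top_of_nonneg hp.le hctop)
        _ < ∞ := ENNReal.mul_lt_top (ENNReal.rpow_lt_top_of_nonneg hp.le hctop) hM.2
    rw [ENNReal.le_div_iff_mul_le (Or.inl (ENNReal.ofReal_pos.2 hq0).ne')
      (Or.inl ENNReal.ofReal_ne_top), mul_comm]
    refine lintegral_rpow_le_of_measure_le hWm.aemeasurable hM.1.aemeasurable hs.1.aemeasurable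
      hMfin hsfin (ae_ne_top_of_lintegral_rpow_lt_top hp hWm.aemeasurable hWp) hp hδ hκ hWp.ne
      fun t ht => ?_
    rw [one_mul, add_assoc]
    refine le_trans (measure_mono fun x hx => ?_) ((measure_union_le _ _).trans
      (add_le_add_right (measure_windowVariation_le hf hδ hδ2 hr ht N) _))
    rcases lt_or_ge (ENNReal.ofReal (δ * t)) (maximalFunction f x) with h | h
    · exact Or.inl h
    · exact Or.inr ⟨hx, h⟩
  calc ∫⁻ x, variation r f x ^ p ∂ν = ∫⁻ x, ⨆ N, windowVariation r f N x ^ p ∂ν := by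
        simp_rw [variation_eq_iSup_windowVariation hr0]
        congr with x
        exact (ENNReal.monotone_rpow_of_nonneg hp.le).map_iSup_of_continuousAt
          ENNReal.continuous_rpow_const.continuousAt (by simp [hp])
    _ = ⨆ N, ∫⁻ x, windowVariation r f N x ^ p ∂ν :=
        lintegral_iSup (fun N => (measurable_windowVariation hf r N).pow_const p)
          fun M N hMN x => ENNReal.rpow_le_rpow (windowVariation_mono hr0 f x hMN) hp.le
    _ ≤ _ := iSup_le hbound
    _ < ∞ := ENNReal.div_lt_top
        (ENNReal.mul_ne_top ENNReal.ofReal_ne_top (ENNReal.add_lt_top.2 ⟨hM.2, hs.2⟩).ne)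
        (ENNReal.ofReal_pos.2 hq0).ne'

end Lp

end MartingaleVariation

theorem theorem1 :
    ∃ C : ℝ, 0 < C ∧
      ∀ (𝕜 : Type*) [RCLike 𝕜] (X : Type*) (mX : MeasurableSpace X)
        (ν : Measure X) [SigmaFinite ν] (ℱ : Filtration ℤ mX) [SigmaFiniteFiltration ν ℱ]
        (f : ℤ → X → 𝕜), MartingaleVariation.IsMartingale ν ℱ f →
        (∀ δ r l : ℝ, 0 < δ → δ < 1 / 2 → 2 < r → 0 < l →
          ENNReal.ofReal C *
              ν {x | ENNReal.ofReal (3 * l) < MartingaleVariation.variation r f x ∧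
                MartingaleVariation.maximalFunction f x ≤ ENNReal.ofReal (δ * l)} ≤
            ν {x | ENNReal.ofReal (δ * l) < MartingaleVariation.condSquareFunction ν ℱ f x} +
              ENNReal.ofReal (δ ^ 2 / (r - 2) ^ 2) *
                ν {x | ENNReal.ofReal l < MartingaleVariation.variation r f x}) ∧
        (∀ p r : ℝ, 0 < p → 2 < r →
          MemLp (MartingaleVariation.condSquareFunction ν ℱ f) (ENNReal.ofReal p) ν →
          MemLp (MartingaleVariation.maximalFunction f) (ENNReal.ofReal p) ν →
          MemLp (MartingaleVariation.variation r f) (ENNReal.ofReal p) ν) := by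
  -- `1 / 16` cancels the factor 16 coming from the thresholds `θ = 2^{-k} D / 4`.
  refine ⟨1 / 16, by norm_num, fun 𝕜 _ X mX ν _ ℱ _ f hf =>
    ⟨fun δ r l hδ hδ2 hr hl => ?_, fun p r hp hr hs hM =>
      MartingaleVariation.memLp_variation hf hp hr hs hM⟩⟩
  have hr2 : 0 < r - 2 := by linarith
  grw [MartingaleVariation.measure_variation_le hf hδ hδ2 hr hl]
  rw [mul_add, ← mul_assoc, ← ENNReal.ofReal_mul (by norm_num)]
  gcongr
  · refine mul_le_of_le_one_left zero_le ?_
    rw [ENNReal.ofReal_le_one]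
    norm_num
  · exact le_of_eq (by ring)
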